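/- Let $n,k$ be integers with $0\le k\le n$ and let $d_0,\dots,d_k\ge 0$ be integers. Write $x=(x_1,\dots,x_n)$, $\tilde x=(x_0,x_1,\dots,x_n)$, and let $\mathbb R[x]_d$ be the space of real polynomials of degree at most $d$. For $p=(p_0,\dots,p_k)\in\mathbb R[x]_{d_0}\times\cdots\times\mathbb R[x]_{d_k}$ (or with complex coefficients) let $\tilde p_i(\tilde x)=x_0^{d_i}p_i(x/x_0)$ be the homogenization of $p_i$ as a polynomial of degree $d_i$, let $\nabla_x,\nabla_x^2$ denote the gradient and Hessian in $x_1,\dots,x_n$ only, and consider the system in $(\tilde x,y)\in\mathbb C^{n+1}\times\mathbb C^n$ $$(\ast)\qquad \operatorname{rank}\tilde P(\tilde x,y)\le 2k,\qquad \tilde p_i(\tilde x)=0,\quad (\nabla_x\tilde p_i(\tilde x))^Ty=0\quad(i=1,\dots,k),$$ where $\tilde P$ is the $2n\times(2k+1)$ matrix $$\tilde P(\tilde x,y)=\begin{bmatrix}\nabla_x\tilde p_0&\cdots&\nabla_x\tilde p_k&0&\cdots&0\\ (\nabla_x^2\tilde p_0)y&\cdots&(\nabla_x^2\tilde p_k)y&\nabla_x\tilde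 p_1&\cdots&\nabla_x\tilde p_k\end{bmatrix}.$$ Then there is a polynomial $\mathscr D(p_0,\dots,p_k)$ with integer coefficients in the coefficients of $p_0,\dots,p_k$ with the following properties. (1) It is obtained by applying elimination theory twice, in this sense: there are finitely many polynomials $G_1,\dots,G_t$ with integer coefficients in the coefficients of the $p_i$ and in $y$, homogeneous in the coefficients of each $p_i$ separately and in $y$, such that for all complex $p$ and all $y\in\mathbb C^n$, $(\ast)$ has a solution $0\ne\tilde x\in\mathbb C^{n+1}$ if and only if $G_1(p,y)=\cdots=G_t(p,y)=0$; and there are finitely many polynomials $D_1,\dots,D_s$ with integer coefficients in the coefficients of the $p_i$, homogeneous in the coefficients of each $p_i$ separately, such that for all complex $p$, $G_1(p,y)=\cdots=G_t(p,y)=0$ for some $0\ne y\in\mathbb C^n$ if and only if $D_1(p)=\cdots=D_s(p)=0$; and $\mathscr D=D_1^2+\cdots+D_s^2$. (2) For all real $p_0\in\mathbb R[x]_{d_0},\dots,p_k\in\mathbb R[x]_{d_k}$: the system $(\ast)$ has a solution $(\tilde x,y)\in\mathbb C^{n+1}\times\mathbb C^n$ with $\tilde x\ne0$ and $y\ne0$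 if and only if $\mathscr D(p_0,\dots,p_k)=0$. (3) In particular, if $\mathscr D(p_0,\dots,p_k)\ne0$ for such real $p_i$, then the KKT system $\nabla p_0(x)-\sum_{i=1}^k\lambda_i\nabla p_i(x)=0$, $p_1(x)=\cdots=p_k(x)=0$ of the problem $\min p_0(x)$ subject to $p_1(x)=\cdots=p_k(x)=0$ is nonsingular, i.e. at each of its solutions $(x,\lambda)\in\mathbb C^n\times\mathbb C^k$ the matrix $$\begin{bmatrix}\nabla_x^2\big(p_0-\sum_{i=1}^k\lambda_ip_i\big)(x)&J(x)^T\\ J(x)&0\end{bmatrix},\qquad J=\mathrm{Jac}(p_1,\dots,p_k),$$ is nonsingular. -/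

import Mathlib

open MvPolynomial

namespace KKTDisc

/-- The homogenization of `f`, a polynomial in `x₁, …, xₙ` of degree at most `d`, as a form of
degree `d` in `x₀, x₁, …, xₙ`: each term `c x^α` becomes `c x₀^(d - |α|) x^α`.
The variable with index `0` is `x₀`, the one with index `a.succ` is the old variable `a`. -/
noncomputable def homogenization {K : Type*} [Field K] {n : ℕ} (d : ℕ)
    (f : MvPolynomial (Fin n) K) : MvPolynomial (Fin (n + 1)) K :=
  ∑ α ∈ f.support, monomial (Finsupp.cons (d - α.degree) α) (f.coeff α)

/-- The gradient of `p` with respect to `x`, evaluated at `x`. -/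
noncomputable def grad {K : Type*} [Field K] {n : ℕ} (p : MvPolynomial (Fin n) K)
    (x : Fin n → K) : Fin n → K :=
  fun a => eval x (pderiv a p)

/-- The Hessian of `p` with respect to `x`, evaluated at `x`. -/
noncomputable def hess {K : Type*} [Field K] {n : ℕ} (p : MvPolynomial (Fin n) K)
    (x : Fin n → K) : Matrix (Fin n) (Fin n) K :=
  Matrix.of fun a b => eval x (pderiv a (pderiv b p))

/-- `∇ₓ q (x̃)` for a polynomial `q` in `x̃ = (x₀, x₁, …, xₙ)`: the derivatives are taken
with respect to `x₁, …, xₙ` only. -/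
noncomputable def gradX {K : Type*} [Field K] {n : ℕ} (q : MvPolynomial (Fin (n + 1)) K)
    (x : Fin (n + 1) → K) : Fin n → K :=
  fun a => eval x (pderiv a.succ q)

/-- `∇ₓ² q (x̃)` for a polynomial `q` in `x̃ = (x₀, x₁, …, xₙ)`: the derivatives are taken
with respect to `x₁, …, xₙ` only. -/
noncomputable def hessX {K : Type*} [Field K] {n : ℕ} (q : MvPolynomial (Fin (n + 1)) K)
    (x : Fin (n + 1) → K) : Matrix (Fin n) (Fin n) K :=
  Matrix.of fun a b => eval x (pderiv a.succ (pderiv b.succ q))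

/-- The `2n × (2k+1)` matrix
`[ ∇ₓp̃₀ ⋯ ∇ₓp̃ₖ              0        ]`
`[ (∇ₓ²p̃₀)y ⋯ (∇ₓ²p̃ₖ)y   ∇ₓp̃₁ ⋯ ∇ₓp̃ₖ ]` at `(x̃, y)`, for `q i = p̃ᵢ`. -/
noncomputable def matrixP {K : Type*} [Field K] {n k : ℕ}
    (q : Fin (k + 1) → MvPolynomial (Fin (n + 1)) K) (x : Fin (n + 1) → K) (y : Fin n → K) :
    Matrix (Fin n ⊕ Fin n) (Fin (k + 1) ⊕ Fin k) K :=
  Matrix.fromBlocks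
    (Matrix.of fun a i => gradX (q i) x a)
    0
    (Matrix.of fun a i => Matrix.mulVec (hessX (q i) x) y a)
    (Matrix.of fun a j => gradX (q j.succ) x a)

/-- The homogenized Hessian-degeneracy system in `(x̃, y)`: `rank P̃(x̃, y) ≤ 2k`,
`p̃ᵢ(x̃) = 0` and `(∇ₓ p̃ᵢ(x̃))ᵀ y = 0` for `i = 1, …, k`,
where `p̃ᵢ` is the homogenization of `pᵢ` as a polynomial of degree (at most) `dᵢ`. -/
def HessianDegeneracy {K : Type*} [Field K] {n k : ℕ} (d : Fin (k + 1) → ℕ)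
    (p : Fin (k + 1) → MvPolynomial (Fin n) K) (x : Fin (n + 1) → K) (y : Fin n → K) : Prop :=
  (matrixP (fun i => homogenization (d i) (p i)) x y).rank ≤ 2 * k ∧
  (∀ j : Fin k, eval x (homogenization (d j.succ) (p j.succ)) = 0) ∧
  (∀ j : Fin k, gradX (homogenization (d j.succ) (p j.succ)) x ⬝ᵥ y = 0)

/-- Indices of the coefficients of a tuple `(p₀, …, pₖ)` of polynomials in `n` variables with
`deg pᵢ ≤ dᵢ`: pairs of an `i` and an exponent `α` with `|α| ≤ dᵢ`. -/
abbrev CoeffIndex (n : ℕ) {k : ℕ} (d : Fin (k + 1) → ℕ) : Type :=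
  Σ i : Fin (k + 1), {α : Fin n →₀ ℕ // α.degree ≤ d i}

/-- The coefficients of the tuple `(p₀, …, pₖ)`. -/
noncomputable def coeffs {K : Type*} [Field K] {n k : ℕ} (d : Fin (k + 1) → ℕ)
    (p : Fin (k + 1) → MvPolynomial (Fin n) K) : CoeffIndex n d → K :=
  fun c => (p c.1).coeff c.2.1

/-- `D` is homogeneous in the coefficients of each of `p₀, …, pₖ` separately. -/
def HomogeneousInEach {n k : ℕ} {d : Fin (k + 1) → ℕ}
    (D : MvPolynomial (CoeffIndex n d) ℤ) : Prop :=
  ∀ i : Fin (k + 1), ∃ m : ℕ,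
    IsWeightedHomogeneous (fun c : CoeffIndex n d => if c.1 = i then 1 else 0) D m

/-- `G`, a polynomial in the coefficients of `p₀, …, pₖ` and in `y₁, …, yₙ`, is homogeneous in
the coefficients of each of `p₀, …, pₖ` separately, and in `y`. -/
def HomogeneousInEachAndY {n k : ℕ} {d : Fin (k + 1) → ℕ}
    (G : MvPolynomial (CoeffIndex n d ⊕ Fin n) ℤ) : Prop :=
  (∀ i : Fin (k + 1), ∃ m : ℕ,
    IsWeightedHomogeneous
      (Sum.elim (fun c : CoeffIndex n d => if c.1 = i then 1 else 0) (fun _ : Fin n => 0)) G m) ∧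
  ∃ m : ℕ,
    IsWeightedHomogeneous (Sum.elim (fun _ : CoeffIndex n d => 0) (fun _ : Fin n => 1)) G m

/-- `G₁, …, G_t` eliminate `x̃` from the Hessian-degeneracy system: they have integer coefficients,
are homogeneous in the coefficients of each `pᵢ` and in `y`, and for given `p` and `y` they all
vanish exactly when the system has a solution `x̃ ≠ 0`. -/
def EliminatesX (n : ℕ) {k : ℕ} (d : Fin (k + 1) → ℕ) {t : ℕ}
    (G : Fin t → MvPolynomial (CoeffIndex n d ⊕ Fin n) ℤ) : Prop :=
  (∀ j, HomogeneousInEachAndY (G j)) ∧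
  ∀ p : Fin (k + 1) → MvPolynomial (Fin n) ℂ, (∀ i, (p i).totalDegree ≤ d i) →
    ∀ y : Fin n → ℂ,
      (∃ x : Fin (n + 1) → ℂ, x ≠ 0 ∧ HessianDegeneracy d p x y) ↔
        ∀ j, aeval (Sum.elim (coeffs d p) y) (G j) = 0

/-- `D₁, …, D_s` eliminate `y` from the system `G₁ = ⋯ = G_t = 0`: they have integer coefficients,
are homogeneous in the coefficients of each `pᵢ`, and for given `p` they all vanish exactly when
`G₁ = ⋯ = G_t = 0` has a solution `y ≠ 0`. -/
def EliminatesY (n : ℕ) {k : ℕ} (d : Fin (k + 1) → ℕ) {t s : ℕ}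
    (G : Fin t → MvPolynomial (CoeffIndex n d ⊕ Fin n) ℤ)
    (D : Fin s → MvPolynomial (CoeffIndex n d) ℤ) : Prop :=
  (∀ j, HomogeneousInEach (D j)) ∧
  ∀ p : Fin (k + 1) → MvPolynomial (Fin n) ℂ, (∀ i, (p i).totalDegree ≤ d i) →
    ((∃ y : Fin n → ℂ, y ≠ 0 ∧ ∀ j, aeval (Sum.elim (coeffs d p) y) (G j) = 0) ↔
      ∀ j, aeval (coeffs d p) (D j) = 0)

/-- `𝓓 = D₁² + ⋯ + D_s²`, where `D₁, …, D_s` result from eliminating first `x̃` and then `y`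
from the homogenized Hessian-degeneracy system. -/
def IsTwofoldEliminant (n : ℕ) {k : ℕ} (d : Fin (k + 1) → ℕ)
    (𝓓 : MvPolynomial (CoeffIndex n d) ℤ) : Prop :=
  ∃ (t s : ℕ) (G : Fin t → MvPolynomial (CoeffIndex n d ⊕ Fin n) ℤ)
    (D : Fin s → MvPolynomial (CoeffIndex n d) ℤ),
    EliminatesX n d G ∧ EliminatesY n d G D ∧ 𝓓 = ∑ j, D j ^ 2

/-- `(x, lam)` is a critical pair: it solves the KKT system `∇p₀(x) - ∑ lamᵢ ∇pᵢ(x) = 0`,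
`p₁(x) = ⋯ = pₖ(x) = 0`. -/
def IsCriticalPair {K : Type*} [Field K] {n k : ℕ} (p : Fin (k + 1) → MvPolynomial (Fin n) K)
    (x : Fin n → K) (lam : Fin k → K) : Prop :=
  grad (p 0) x - ∑ j, lam j • grad (p j.succ) x = 0 ∧ ∀ j : Fin k, eval x (p j.succ) = 0

/-- The Lagrangian `p₀ - ∑ lamᵢ pᵢ`, for fixed multipliers. -/
noncomputable def lagrangian {K : Type*} [Field K] {n k : ℕ}
    (p : Fin (k + 1) → MvPolynomial (Fin n) K) (lam : Fin k → K) : MvPolynomial (Fin n) K :=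
  p 0 - ∑ j, C (lam j) * p j.succ

/-- The Jacobian matrix of `(p₁, …, pₖ)` at `x`. -/
noncomputable def jac {K : Type*} [Field K] {n k : ℕ} (p : Fin (k + 1) → MvPolynomial (Fin n) K)
    (x : Fin n → K) : Matrix (Fin k) (Fin n) K :=
  Matrix.of fun j a => grad (p j.succ) x a

/-- The matrix `H_p(x, lam)` with blocks `∇ₓ²L_p(x, lam)`, `Jacᵀ`, `Jac` and `0`. -/
noncomputable def kktMatrix {K : Type*} [Field K] {n k : ℕ}
    (p : Fin (k + 1) → MvPolynomial (Fin n) K) (x : Fin n → K) (lam : Fin k → K) :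
    Matrix (Fin n ⊕ Fin k) (Fin n ⊕ Fin k) K :=
  Matrix.fromBlocks (hess (lagrangian p lam) x) (jac p x).transpose (jac p x) 0

/-- The KKT system of `(p₀, …, pₖ)` is nonsingular (over `K`): `H_p(x, lam)` is nonsingular at
every critical pair. -/
def KKTNonsingular {K : Type*} [Field K] {n k : ℕ}
    (p : Fin (k + 1) → MvPolynomial (Fin n) K) : Prop :=
  ∀ (x : Fin n → K) (lam : Fin k → K), IsCriticalPair p x lam → (kktMatrix p x lam).det ≠ 0

/-- A tuple of real polynomials, seen as a tuple of complex polynomials. -/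
noncomputable def complexify {n k : ℕ} (p : Fin (k + 1) → MvPolynomial (Fin n) ℝ) :
    Fin (k + 1) → MvPolynomial (Fin n) ℂ :=
  fun i => MvPolynomial.map (algebraMap ℝ ℂ) (p i)

end KKTDisc

/-! The rank condition in $(\ast)$ says that the maximal minors of $\tilde P$ vanish, so $(\ast)$ is
a system of polynomial equations with integer coefficients, homogeneous separately in the
coefficients of each $p_i$, in $y$ and in $\tilde x$. Elimination theory therefore applies to
$\tilde x$, and then to $y$.

Elimination (`exists_eliminants`) runs as follows. By the Nullstellensatz, forms $f_j$ over an
algebraically closed field have only the trivial common zero iff their ideal contains all monomials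
of some degree $N$. For fixed $N$ this means that the coefficient vectors of the products $x^\beta
f_j$ span, i.e. that some determinant formed from them is nonzero. So a nontrivial zero exists iff
all these determinants, for all $N$, vanish. They are polynomials in the parameters and inherit
homogeneity, and by Hilbert's basis theorem finitely many of them suffice.

For real $p$ the $D_j(p)$ are real, so $\sum D_j^2$ vanishes only if every $D_j$ does. For (3),
`exists_hessianDegeneracy_of_det_eq_zero` turns a kernel vector $(y,\mu)$ of a singular KKT matrix
into a solution of $(\ast)$ at $\tilde x=(1,x)$: the vector $(1,-\lambda,\mu)$ lies in the kernel of
$\tilde P$. If $y=0$, the constraint gradients are dependent, and $k\le n$ provides another $y$. -/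

namespace KKTDisc

/-! ### Determinants and weighted homogeneity -/

/-- Vectors span `ρ → K` if and only if some `ρ`-indexed choice among them has nonzero
determinant. -/
theorem span_range_eq_top_iff_exists_det {K ρ γ : Type*} [Field K] [Fintype ρ] [DecidableEq ρ]
    (v : γ → ρ → K) :
    Submodule.span K (Set.range v) = ⊤ ↔
      ∃ c : ρ → γ, (Matrix.of fun a => v (c a)).det ≠ 0 := by
  constructor
  · intro h
    obtain ⟨κ, a, -, hsp, hli⟩ := exists_linearIndependent' K v
    let b : Module.Basis κ K (ρ → K) := Module.Basis.mk hli (by rw [hsp, h])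
    let e : ρ ≃ κ := (Pi.basisFun K ρ).indexEquiv b
    refine ⟨a ∘ e, fun h0 => ?_⟩
    obtain ⟨u, hu, hu0⟩ := Matrix.exists_vecMul_eq_zero_iff.mpr h0
    refine hu ?_
    have hli' := hli.comp e e.injective
    rw [Fintype.linearIndependent_iff] at hli'
    ext i
    refine hli' u ?_ i
    rw [← hu0]
    ext j
    simp [Matrix.vecMul, dotProduct]
  · rintro ⟨c, hc⟩
    have hli := Matrix.linearIndependent_rows_of_det_ne_zero hc
    have h := hli.span_eq_top_of_card_eq_finrank' (by simp)
    refine top_le_iff.mp (h.ge.trans (Submodule.span_mono ?_))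
    rintro _ ⟨i, rfl⟩
    exact ⟨c i, rfl⟩

/-- The determinant of a matrix whose entries are homogeneous of degree
`(row degree) + (column degree)`. -/
theorem isWeightedHomogeneous_det {R σ M ρ : Type*} [CommRing R] [AddCommMonoid M] [Fintype ρ]
    [DecidableEq ρ] {w : σ → M} (A : Matrix ρ ρ (MvPolynomial σ R)) (r c : ρ → M)
    (h : ∀ a b, IsWeightedHomogeneous w (A a b) (r a + c b)) :
    IsWeightedHomogeneous w A.det (∑ a, r a + ∑ b, c b) := by
  rw [Matrix.det_apply]
  refine IsWeightedHomogeneous.sum _ _ _ fun σ _ => ?_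
  -- Every Leibniz term meets each row and each column once, so its degree does not depend on the
  -- permutation.
  have hprod : IsWeightedHomogeneous w (∏ i, A (σ i) i) (∑ a, r a + ∑ b, c b) := by
    have := IsWeightedHomogeneous.prod Finset.univ (fun i => A (σ i) i)
      (fun i => r (σ i) + c i) fun i _ => h (σ i) i
    rwa [Finset.sum_add_distrib, Equiv.sum_comp σ r] at this
  rw [← mem_weightedHomogeneousSubmodule] at hprod ⊢
  rw [Units.smul_def]
  exact zsmul_mem hprod _

/-- Homogeneity is preserved when the weights are mapped by an additive map. -/
theorem isWeightedHomogeneous_comp {R σ M N : Type*} [CommSemiring R] [AddCommMonoid M]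
    [AddCommMonoid N] {w : σ → M} {f : MvPolynomial σ R} {m : M}
    (h : IsWeightedHomogeneous w f m) (g : M →+ N) {w' : σ → N} (hw : ∀ i, w' i = g (w i)) :
    IsWeightedHomogeneous w' f (g m) := by
  intro s hs
  simp [← h hs, Finsupp.weight_apply, Finsupp.sum, map_sum, hw]

theorem isWeightedHomogeneous_of_eq {R σ M : Type*} [CommSemiring R] [AddCommMonoid M]
    {w : σ → M} {f : MvPolynomial σ R} {m m' : M} (h : IsWeightedHomogeneous w f m)
    (hm : m = m') : IsWeightedHomogeneous w f m' :=
  hm ▸ h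

/-- A polynomial which is homogeneous with respect to natural weights regarded as integers is
homogeneous with respect to the natural weights. -/
theorem exists_isWeightedHomogeneous_nat {R σ : Type*} [CommSemiring R] {w : σ → ℕ}
    {f : MvPolynomial σ R} {m : ℤ} (h : IsWeightedHomogeneous (fun i => (w i : ℤ)) f m) :
    ∃ e : ℕ, IsWeightedHomogeneous w f e := by
  have key : ∀ s : σ →₀ ℕ, (Finsupp.weight (fun i => (w i : ℤ)) s : ℤ) = (Finsupp.weight w s : ℕ) := by
    intro s
    simp [Finsupp.weight_apply, Finsupp.sum]
  refine ⟨m.toNat, fun s hs => ?_⟩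
  rw [← h hs, key, Int.toNat_natCast]

/-! ### Projective Nullstellensatz, degree by degree -/

section Nullstellensatz

variable {K ι J : Type*} [Field K]

/-- Homogeneous polynomials over an algebraically closed field have no common zero except `0` if
and only if the ideal they generate contains all monomials of some degree. -/
theorem forall_zero_eq_zero_iff_exists_monomial_mem [IsAlgClosed K] [Fintype ι]
    (f : J → MvPolynomial ι K) :
    (∀ x : ι → K, (∀ j, eval x (f j) = 0) → x = 0) ↔
      ∃ N : ℕ, ∀ s : ι →₀ ℕ, s.degree = N → monomial s 1 ∈ Ideal.span (Set.range f) := by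
  classical
  constructor
  · intro h
    -- The zero locus is contained in `{0}`, so every variable vanishes on it and lies in the
    -- radical; finite generation then puts a power of the ideal of the variables inside the ideal.
    have hle : Ideal.span (Set.range (X : ι → MvPolynomial ι K)) ≤
        (Ideal.span (Set.range f)).radical := by
      rw [← vanishingIdeal_zeroLocus_eq_radical (K := K), Ideal.span_le]
      rintro _ ⟨i, rfl⟩
      rw [SetLike.mem_coe, mem_vanishingIdeal_iff]
      intro x hx
      have : x = 0 := h x fun j => by
        simpa [aeval_eq_eval] using hx (f j) (Ideal.subset_span ⟨j, rfl⟩)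
      simp [this]
    obtain ⟨N, hN⟩ := Ideal.exists_pow_le_of_le_radical_of_fg hle
      (Submodule.fg_span (Set.finite_range _))
    refine ⟨N, fun s hs => hN ?_⟩
    rw [monomial_eq, C_1, one_mul, Finsupp.prod_fintype _ _ (by simp), ← hs,
      Finsupp.degree_eq_sum, ← Finset.prod_pow_eq_pow_sum]
    exact Ideal.prod_mem_prod fun i _ => Ideal.pow_mem_pow (Ideal.subset_span (Set.mem_range_self i)) _
  · rintro ⟨N, hN⟩ x hx
    ext i
    have hle : Ideal.span (Set.range f) ≤ RingHom.ker (eval x) := by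
      rw [Ideal.span_le]
      rintro _ ⟨j, rfl⟩
      exact hx j
    have := hle (hN (Finsupp.single i N) (by simp))
    simp only [RingHom.mem_ker, eval_monomial, one_mul] at this
    rw [Finsupp.prod_single_index (by simp)] at this
    exact eq_zero_of_pow_eq_zero this

/-- An ideal generated by homogeneous polynomials `f j` contains all monomials of degree `N` if
and only if the coefficient vectors, in degree `N`, of the products `x ^ β * f j` span. -/
theorem monomial_mem_span_iff_span_coeff_eq_top [Finite ι] (f : J → MvPolynomial ι K)
    (hf : ∀ j, ∃ e, (f j).IsHomogeneous e) (N : ℕ) :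
    (∀ s : ι →₀ ℕ, s.degree = N → monomial s 1 ∈ Ideal.span (Set.range f)) ↔
      Submodule.span K (Set.range fun (c : J × (ι →₀ ℕ)) (s : {s : ι →₀ ℕ // s.degree = N}) =>
        coeff s.1 (monomial c.2 1 * f c.1)) = ⊤ := by
  classical
  set v : J × (ι →₀ ℕ) → {s : ι →₀ ℕ // s.degree = N} → K :=
    fun c s => coeff s.1 (monomial c.2 1 * f c.1) with hv
  let T : MvPolynomial ι K →ₗ[K] ({s : ι →₀ ℕ // s.degree = N} → K) :=
    LinearMap.pi fun s => lcoeff K s.1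
  have hT : ∀ g s, T g s = coeff s.1 g := fun g s => rfl
  -- The ideal is a span over the polynomial ring, the target only a span over `K`. Quantifying over
  -- the multiplier `p` carries the induction through multiplication by polynomials.
  have hmem : ∀ g ∈ Ideal.span (Set.range f), ∀ p : MvPolynomial ι K,
      T (p * g) ∈ Submodule.span K (Set.range v) := by
    intro g hg
    induction hg using Submodule.span_induction with
    | mem g hg =>
      obtain ⟨j, rfl⟩ := hg
      intro p
      induction p using MvPolynomial.induction_on' with
      | monomial s a =>
        have : monomial s a * f j = a • (monomial s 1 * f j) := by
          rw [← smul_mul_assoc, smul_monomial, smul_eq_mul, mul_one]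
        rw [this, map_smul]
        exact Submodule.smul_mem _ _ (Submodule.subset_span ⟨(j, s), rfl⟩)
      | add p q hp hq =>
        rw [add_mul, map_add]
        exact add_mem hp hq
    | zero => simp
    | add g h _ _ hg hh =>
      intro p
      rw [mul_add, map_add]
      exact add_mem (hg p) (hh p)
    | smul a g _ hg =>
      intro p
      rw [smul_eq_mul, ← mul_assoc]
      exact hg _
  have hle : Submodule.span K (Set.range v) ≤
      ((Ideal.span (Set.range f)).restrictScalars K).map T := by
    rw [Submodule.span_le]
    rintro _ ⟨c, rfl⟩
    exact ⟨monomial c.2 1 * f c.1, Ideal.mul_mem_left _ _ (Ideal.subset_span ⟨c.1, rfl⟩), rfl⟩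
  constructor
  · intro h
    have hfin : Finite {s : ι →₀ ℕ // s.degree = N} := (Finsupp.finite_of_degree_eq N).to_subtype
    have := Fintype.ofFinite {s : ι →₀ ℕ // s.degree = N}
    rw [← top_le_iff, ← (Pi.basisFun K _).span_eq, Submodule.span_le]
    rintro _ ⟨s, rfl⟩
    have hs : Pi.basisFun K _ s = T (1 * monomial s.1 1) := by
      ext t
      rw [one_mul, hT, coeff_monomial, Pi.basisFun_apply, Pi.single_apply]
      simp only [Subtype.ext_iff, eq_comm]
    rw [hs]
    exact hmem _ (h s.1 s.2) 1
  · intro h s hs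
    -- Some `g` in the ideal agrees with the monomial in degree `N`. Since the ideal is homogeneous,
    -- it also contains the degree `N` part of `g`, which is the monomial itself.
    obtain ⟨g, hg, hgs⟩ := hle (h.ge (Submodule.mem_top (x := Pi.single ⟨s, hs⟩ 1)))
    let _ := weightedGradedAlgebra K (1 : ι → ℕ)
    have hI : (Ideal.span (Set.range f)).IsHomogeneous (weightedHomogeneousSubmodule K (1 : ι → ℕ)) := by
      refine Ideal.homogeneous_span _ _ ?_
      rintro _ ⟨j, rfl⟩
      exact hf j
    have hg' : homogeneousComponent N g ∈ Ideal.span (Set.range f) :=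
      weightedHomogeneousComponent_mem_of_mem K 1 hI hg N
    convert hg'
    ext t
    rw [coeff_homogeneousComponent, coeff_monomial]
    split_ifs with h1 h2 h2
    · subst h1
      rw [← hT g ⟨s, hs⟩, hgs, Pi.single_eq_same]
    · exact absurd (h1 ▸ hs) h2
    · rw [← hT g ⟨t, h2⟩, hgs, Pi.single_eq_of_ne]
      exact fun h => h1 (congrArg Subtype.val h).symm
    · rfl

end Nullstellensatz

/-! ### Main theorem of elimination theory -/

section Elimination

variable {R P ι : Type*} [CommRing R]

/-- A polynomial in two groups of variables as a polynomial in the second group, whose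
coefficients are polynomials in the first group. -/
noncomputable def asPolynomialIn (R P ι : Type*) [CommRing R] :
    MvPolynomial (P ⊕ ι) R →ₐ[R] MvPolynomial ι (MvPolynomial P R) :=
  aeval (Sum.elim (fun a => C (X a)) X)

/-- Splitting exponents into their two halves allows homogeneity in either group of variables to be
checked term by term. -/
theorem asPolynomialIn_monomial [Fintype P] [Fintype ι] (s : P ⊕ ι →₀ ℕ) (c : R) :
    asPolynomialIn R P ι (monomial s c) =
      monomial (s.comapDomain Sum.inr Sum.inr_injective.injOn)
        (monomial (s.comapDomain Sum.inl Sum.inl_injective.injOn) c) := by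
  rw [asPolynomialIn, aeval_monomial, monomial_eq (R := MvPolynomial P R), monomial_eq (R := R),
    Finsupp.prod_fintype _ _ (by simp), Finsupp.prod_fintype _ _ (by simp),
    Finsupp.prod_fintype _ _ (by simp), Fintype.prod_sum_type]
  simp [mul_assoc, MvPolynomial.algebraMap_eq, IsScalarTower.algebraMap_apply R (MvPolynomial P R)
    (MvPolynomial ι (MvPolynomial P R))]

theorem eval_map_asPolynomialIn {K : Type*} [Field K] [Algebra R K] (θ : P → K) (x : ι → K)
    (F : MvPolynomial (P ⊕ ι) R) :
    eval x (map (aeval θ : MvPolynomial P R →ₐ[R] K).toRingHom (asPolynomialIn R P ι F)) =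
      aeval (Sum.elim θ x) F := by
  induction F using MvPolynomial.induction_on with
  | C a => simp [asPolynomialIn, IsScalarTower.algebraMap_apply R (MvPolynomial P R)
    (MvPolynomial ι (MvPolynomial P R)), MvPolynomial.algebraMap_eq]
  | add p q hp hq => simp only [map_add, hp, hq]
  | mul_X p i hp =>
    simp only [map_mul, hp]
    rcases i with i | i <;> simp [asPolynomialIn]

theorem asPolynomialIn_isHomogeneous [Fintype P] [Fintype ι] {F : MvPolynomial (P ⊕ ι) R} {e : ℕ}
    (h : IsWeightedHomogeneous (Sum.elim (fun _ => 0) (fun _ => 1)) F e) :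
    (asPolynomialIn R P ι F).IsHomogeneous e := by
  rw [F.as_sum, map_sum]
  refine IsHomogeneous.sum _ _ _ fun s hs => ?_
  rw [asPolynomialIn_monomial]
  refine isHomogeneous_monomial _ ?_
  rw [← h (mem_support_iff.mp hs), Finsupp.weight_eq_sum, Fintype.sum_sum_type,
    Finsupp.degree_eq_sum]
  simp

theorem coeff_asPolynomialIn_isWeightedHomogeneous [Fintype P] [Fintype ι] {M : Type*}
    [AddCommMonoid M] {w : P → M} {F : MvPolynomial (P ⊕ ι) R} {m : M}
    (h : IsWeightedHomogeneous (Sum.elim w (fun _ => 0)) F m) (s : ι →₀ ℕ) :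
    IsWeightedHomogeneous w (coeff s (asPolynomialIn R P ι F)) m := by
  classical
  rw [F.as_sum, map_sum, coeff_sum]
  refine IsWeightedHomogeneous.sum _ _ _ fun t ht => ?_
  rw [asPolynomialIn_monomial, coeff_monomial]
  split_ifs
  · refine isWeightedHomogeneous_monomial _ _ _ ?_
    rw [← h (mem_support_iff.mp ht), Finsupp.weight_eq_sum, Finsupp.weight_eq_sum,
      Fintype.sum_sum_type]
    simp
  · exact isWeightedHomogeneous_zero _ _ _

/-- The main theorem of elimination theory: for forms in `ι` whose coefficients are polynomials
in the parameters `P`, homogeneous with respect to a grading of the parameters, there are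
finitely many polynomials in the parameters, homogeneous as well, which vanish exactly when the
forms have a common nontrivial zero. -/
theorem exists_eliminants [IsNoetherianRing R] (K : Type*) [Field K] [IsAlgClosed K] [Algebra R K]
    [Fintype P] [Fintype ι] {J M : Type*} [AddCommMonoid M] (w : P → M)
    (F : J → MvPolynomial (P ⊕ ι) R)
    (hF : ∀ j, ∃ e : ℕ, IsWeightedHomogeneous (Sum.elim (fun _ => 0) (fun _ => 1)) (F j) e)
    (hw : ∀ j, ∃ m, IsWeightedHomogeneous (Sum.elim w (fun _ => 0)) (F j) m) :
    ∃ (t : ℕ) (G : Fin t → MvPolynomial P R),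
      (∀ j, ∃ m, IsWeightedHomogeneous w (G j) m) ∧
      ∀ θ : P → K, (∃ x : ι → K, x ≠ 0 ∧ ∀ j, aeval (Sum.elim θ x) (F j) = 0) ↔
        ∀ j, aeval θ (G j) = 0 := by
  classical
  have hfin : ∀ N, Finite {s : ι →₀ ℕ // s.degree = N} := fun N =>
    (Finsupp.finite_of_degree_eq N).to_subtype
  have := fun N => Fintype.ofFinite {s : ι →₀ ℕ // s.degree = N}
  choose m hm using hw
  let f : J → MvPolynomial ι (MvPolynomial P R) := fun j => asPolynomialIn R P ι (F j)
  let A : (N : ℕ) → ({s : ι →₀ ℕ // s.degree = N} → J × (ι →₀ ℕ)) →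
      Matrix {s : ι →₀ ℕ // s.degree = N} {s : ι →₀ ℕ // s.degree = N} (MvPolynomial P R) :=
    fun N c => Matrix.of fun a s => coeff s.1 (monomial (c a).2 1 * f (c a).1)
  -- Multiplication by a monomial only shifts coefficients, so all entries of row `a` have the
  -- parameter degree of `F (c a).1`.
  have hA : ∀ N c, ∃ e, IsWeightedHomogeneous w (A N c).det e := by
    intro N c
    refine ⟨_, isWeightedHomogeneous_det (A N c) (fun a => m (c a).1) (fun _ => 0) fun a b => ?_⟩
    change IsWeightedHomogeneous w (coeff b.1 (monomial (c a).2 1 * f (c a).1)) _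
    rw [add_zero, coeff_monomial_mul']
    split_ifs
    · rw [one_mul]
      exact coeff_asPolynomialIn_isWeightedHomogeneous (hm _) _
    · exact isWeightedHomogeneous_zero _ _ _
  have hzero : ∀ θ : P → K, (∃ x : ι → K, x ≠ 0 ∧ ∀ j, aeval (Sum.elim θ x) (F j) = 0) ↔
      ∀ N c, aeval θ (A N c).det = 0 := by
    intro θ
    let φ : MvPolynomial P R →+* K := (aeval θ : MvPolynomial P R →ₐ[R] K).toRingHom
    have h1 := forall_zero_eq_zero_iff_exists_monomial_mem fun j => map φ (f j)
    simp only [monomial_mem_span_iff_span_coeff_eq_top (fun j => map φ (f j)) fun j =>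
      ⟨_, (asPolynomialIn_isHomogeneous (hF j).choose_spec).map φ⟩,
      span_range_eq_top_iff_exists_det] at h1
    have h2 : ∀ N c, aeval θ (A N c).det = (Matrix.of fun a
        (s : {s : ι →₀ ℕ // s.degree = N}) =>
          coeff s.1 (monomial (c a).2 1 * map φ (f (c a).1))).det := by
      intro N c
      change φ _ = _
      rw [RingHom.map_det]
      congr 1
      ext a s
      simp only [A, RingHom.mapMatrix_apply, Matrix.map_apply, Matrix.of_apply]
      rw [← coeff_map, map_mul, map_monomial, map_one]
    simp only [h2]
    rw [← not_iff_not]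
    push Not
    rw [← h1]
    simp only [φ, f, eval_map_asPolynomialIn]
    refine forall_congr' fun x => ?_
    constructor
    · intro h h'
      by_contra! hx
      obtain ⟨j, hj⟩ := h hx
      exact hj (h' j)
    · intro h hx
      by_contra! h'
      exact hx (h h')
  -- The generators are chosen inside `S`, not merely in its span, so that they are still
  -- homogeneous.
  let S : Set (MvPolynomial P R) := {g | ∃ N c, (A N c).det = g}
  obtain ⟨T, hTS, hT⟩ := (Submodule.fg_span_iff_fg_span_finset_subset S).mp
    (IsNoetherian.noetherian (Ideal.span S))
  refine ⟨T.card, fun j => (T.equivFin.symm j).1, fun j => ?_, fun θ => ?_⟩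
  · obtain ⟨N, c, h⟩ := hTS (T.equivFin.symm j).2
    have := hA N c
    rwa [h] at this
  · rw [hzero]
    constructor
    · intro h j
      obtain ⟨N, c, h'⟩ := hTS (T.equivFin.symm j).2
      have := h N c
      rwa [h'] at this
    · intro h N c
      have hle : Submodule.span (MvPolynomial P R) (T : Set (MvPolynomial P R)) ≤
          RingHom.ker (aeval θ : MvPolynomial P R →ₐ[R] K) := by
        rw [Submodule.span_le]
        intro g hg
        simpa using h (T.equivFin ⟨g, hg⟩)
      exact hle (hT ▸ Submodule.subset_span ⟨N, c, rfl⟩)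

end Elimination

/-! ### Multigradings, derivatives under substitution, rank and minors -/

/-- Homogeneity with respect to a tuple of gradings can be tested on each of them. -/
theorem isWeightedHomogeneous_pi {R σ I M : Type*} [CommSemiring R] [AddCommMonoid M]
    {w : σ → I → M} {f : MvPolynomial σ R} {m : I → M}
    (h : ∀ i, IsWeightedHomogeneous (fun a => w a i) f (m i)) : IsWeightedHomogeneous w f m := by
  intro s hs
  ext i
  rw [← h i hs, Finsupp.weight_apply, Finsupp.weight_apply, Finsupp.sum, Finsupp.sum,
    Finset.sum_apply]
  rfl

/-- Chain rule in which a single summand survives. It serves both the specialization of coefficients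
and the substitution `x₀ = 1`. -/
theorem pderiv_aeval_of_forall {R K σ τ : Type*} [CommRing R] [CommRing K] [Algebra R K]
    [DecidableEq σ] (g : σ → MvPolynomial τ K) (i : σ) (a : τ)
    (h : ∀ s, pderiv a (g s) = if s = i then 1 else 0) (q : MvPolynomial σ R) :
    pderiv a (aeval g q) = aeval g (pderiv i q) := by
  induction q using MvPolynomial.induction_on with
  | C r => simp [IsScalarTower.algebraMap_apply R K (MvPolynomial τ K), MvPolynomial.algebraMap_eq]
  | add p q hp hq => simp only [map_add, hp, hq]
  | mul_X p s hp =>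
    rw [map_mul, pderiv_mul, pderiv_mul, hp, aeval_X, h, map_add, map_mul, map_mul, aeval_X]
    split_ifs with hs
    · subst hs
      rw [pderiv_X_self, map_one]
    · rw [pderiv_X_of_ne hs, map_zero]

/-- A matrix has rank less than its number of columns if and only if it has a nonzero kernel
vector. -/
theorem rank_lt_card_iff_exists_mulVec_eq_zero {K m n : Type*} [Field K] [Fintype m] [Fintype n]
    (A : Matrix m n K) : A.rank < Fintype.card n ↔ ∃ v ≠ 0, A.mulVec v = 0 := by
  have h := A.mulVecLin.finrank_range_add_finrank_ker
  rw [Module.finrank_pi] at h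
  change A.rank + _ = _ at h
  rw [← h, Nat.lt_add_right_iff_pos, Module.finrank_pos_iff, Submodule.nontrivial_iff_ne_bot,
    Submodule.ne_bot_iff]
  simp [and_comm]

/-- A matrix has rank less than its number of columns if and only if its maximal minors vanish. -/
theorem rank_lt_card_iff_det_eq_zero {K m n : Type*} [Field K] [Fintype m] [Fintype n]
    [DecidableEq n] (A : Matrix m n K) :
    A.rank < Fintype.card n ↔ ∀ c : n → m, (Matrix.of fun b => A (c b)).det = 0 := by
  rw [← not_iff_not]
  push Not
  -- Full column rank means that the rows span. The choice `c` may repeat rows, which only adds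
  -- minors that are zero.
  rw [← span_range_eq_top_iff_exists_det fun a => A a, A.rank_eq_finrank_span_row]
  constructor
  · intro h
    refine Submodule.eq_top_of_finrank_eq (le_antisymm (Submodule.finrank_le _) ?_)
    rwa [Module.finrank_pi]
  · intro h
    change _ ≤ Module.finrank K (Submodule.span K (Set.range fun a => A a))
    rw [h, finrank_top, Module.finrank_pi]

/-! ### The system with indeterminate coefficients and its multidegrees -/

section UniversalForm

variable {n k : ℕ}

noncomputable instance fintypeExponents (n m : ℕ) : Fintype {α : Fin n →₀ ℕ // α.degree ≤ m} :=
  have : Finite {α : Fin n →₀ ℕ // α.degree ≤ m} := (Finsupp.finite_of_degree_le m).to_subtype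
  Fintype.ofFinite _

/-- The coefficients of `p₀, …, pₖ`, the coordinates of `y` and those of `x̃`. -/
abbrev Variables (n : ℕ) {k : ℕ} (d : Fin (k + 1) → ℕ) : Type :=
  (CoeffIndex n d ⊕ Fin n) ⊕ Fin (n + 1)

/-- The form `p̃ᵢ` with indeterminate coefficients. -/
noncomputable def universalForm (n : ℕ) {k : ℕ} (d : Fin (k + 1) → ℕ) (i : Fin (k + 1)) :
    MvPolynomial (Variables n d) ℤ :=
  ∑ α : {α : Fin n →₀ ℕ // α.degree ≤ d i}, X (Sum.inl (Sum.inl ⟨i, α⟩)) *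
    (X (Sum.inr 0) ^ (d i - α.1.degree) * ∏ a, X (Sum.inr (Fin.succ a)) ^ α.1 a)

/-- The gradient of `universalForm` with respect to `x`. -/
noncomputable def universalGrad (n : ℕ) {k : ℕ} (d : Fin (k + 1) → ℕ) (i : Fin (k + 1))
    (a : Fin n) : MvPolynomial (Variables n d) ℤ :=
  pderiv (Sum.inr a.succ) (universalForm n d i)

/-- The product of the Hessian of `universalForm` with `y`. -/
noncomputable def universalHessMul (n : ℕ) {k : ℕ} (d : Fin (k + 1) → ℕ) (i : Fin (k + 1))
    (a : Fin n) : MvPolynomial (Variables n d) ℤ :=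
  ∑ b : Fin n, pderiv (Sum.inr a.succ) (universalGrad n d i b) * X (Sum.inl (Sum.inr b))

/-- The matrix `P̃` with indeterminate coefficients. -/
noncomputable def universalMatrix (n : ℕ) {k : ℕ} (d : Fin (k + 1) → ℕ) :
    Matrix (Fin n ⊕ Fin n) (Fin (k + 1) ⊕ Fin k) (MvPolynomial (Variables n d) ℤ) :=
  Matrix.fromBlocks (Matrix.of fun a i => universalGrad n d i a) 0
    (Matrix.of fun a i => universalHessMul n d i a)
    (Matrix.of fun a j => universalGrad n d j.succ a)

/-- The equations of the Hessian-degeneracy system: the `p̃ᵢ`, the `(∇p̃ᵢ)ᵀ y` and the maximal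
minors of `P̃`. -/
noncomputable def degeneracyEquation (n : ℕ) {k : ℕ} (d : Fin (k + 1) → ℕ) :
    (Fin k ⊕ Fin k) ⊕ (Fin (k + 1) ⊕ Fin k → Fin n ⊕ Fin n) → MvPolynomial (Variables n d) ℤ
  | Sum.inl (Sum.inl j) => universalForm n d j.succ
  | Sum.inl (Sum.inr j) => ∑ a, universalGrad n d j.succ a * X (Sum.inl (Sum.inr a))
  | Sum.inr c => (Matrix.of fun b => universalMatrix n d (c b)).det

/-- The multidegree of a variable: its degrees in the coefficients of each of `p₀, …, pₖ`, in `y`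
and in `x̃`. -/
def multidegree (n : ℕ) {k : ℕ} (d : Fin (k + 1) → ℕ) :
    Variables n d → ((Fin (k + 1) → ℤ) × ℤ) × ℤ
  | Sum.inl (Sum.inl c) => ((fun i => if c.1 = i then 1 else 0, 0), 0)
  | Sum.inl (Sum.inr _) => ((0, 1), 0)
  | Sum.inr _ => ((0, 0), 1)

theorem universalForm_isWeightedHomogeneous (d : Fin (k + 1) → ℕ) (i : Fin (k + 1)) :
    IsWeightedHomogeneous (multidegree n d) (universalForm n d i)
      ((fun l => if i = l then 1 else 0, 0), (d i : ℤ)) := by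
  refine IsWeightedHomogeneous.sum _ _ _ fun α _ => ?_
  convert (isWeightedHomogeneous_X ℤ (multidegree n d) (Sum.inl (Sum.inl ⟨i, α⟩))).mul
    (((isWeightedHomogeneous_X ℤ (multidegree n d) (Sum.inr 0)).pow _).mul
      (IsWeightedHomogeneous.prod Finset.univ _ _ fun a _ =>
        (isWeightedHomogeneous_X ℤ (multidegree n d) (Sum.inr (Fin.succ a))).pow (α.1 a))) using 1
  have h : ((d i - α.1.degree : ℕ) : ℤ) + ∑ a, (α.1 a : ℤ) = d i := by
    rw [← Nat.cast_sum, ← Finsupp.degree_eq_sum, ← Nat.cast_add, Nat.sub_add_cancel α.2]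
  refine Prod.ext (Prod.ext ?_ ?_) ?_ <;>
    simp [multidegree, Prod.fst_sum, Prod.snd_sum, h]

/-- Integer degrees avoid a case distinction: for `d i = 0` the degree is `-1`, but the gradient is
zero, hence homogeneous of every degree. -/
theorem universalGrad_isWeightedHomogeneous (d : Fin (k + 1) → ℕ) (i : Fin (k + 1)) (a : Fin n) :
    IsWeightedHomogeneous (multidegree n d) (universalGrad n d i a)
      ((fun l => if i = l then 1 else 0, 0), (d i : ℤ) - 1) :=
  (universalForm_isWeightedHomogeneous d i).pderiv (by simp [multidegree])

theorem universalHessMul_isWeightedHomogeneous (d : Fin (k + 1) → ℕ) (i : Fin (k + 1))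
    (a : Fin n) :
    IsWeightedHomogeneous (multidegree n d) (universalHessMul n d i a)
      ((fun l => if i = l then 1 else 0, 1), (d i : ℤ) - 2) := by
  refine IsWeightedHomogeneous.sum _ _ _ fun b _ => ?_
  refine isWeightedHomogeneous_of_eq (((universalGrad_isWeightedHomogeneous d i b).pderiv
    (n' := ((fun l => if i = l then 1 else 0, 0), (d i : ℤ) - 2)) (i := Sum.inr a.succ) ?_).mul
    (isWeightedHomogeneous_X ℤ (multidegree n d) (Sum.inl (Sum.inr b)))) ?_
  · simp only [multidegree, Prod.mk_add_mk, add_zero]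
    congr 1
    ring
  · simp [multidegree]

theorem degeneracyEquation_isWeightedHomogeneous (d : Fin (k + 1) → ℕ)
    (j : (Fin k ⊕ Fin k) ⊕ (Fin (k + 1) ⊕ Fin k → Fin n ⊕ Fin n)) :
    ∃ m, IsWeightedHomogeneous (multidegree n d) (degeneracyEquation n d j) m := by
  rcases j with (j | j) | c
  · exact ⟨_, universalForm_isWeightedHomogeneous d j.succ⟩
  · exact ⟨_, IsWeightedHomogeneous.sum _ _ _ fun a _ =>
      (universalGrad_isWeightedHomogeneous d j.succ a).mul
        (isWeightedHomogeneous_X ℤ (multidegree n d) (Sum.inl (Sum.inr a)))⟩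
  · let row : Fin n ⊕ Fin n → ((Fin (k + 1) → ℤ) × ℤ) × ℤ :=
      Sum.elim (fun _ => 0) (fun _ => ((0, 1), -1))
    let col : Fin (k + 1) ⊕ Fin k → ((Fin (k + 1) → ℤ) × ℤ) × ℤ :=
      Sum.elim (fun i => ((fun l => if i = l then 1 else 0, 0), (d i : ℤ) - 1))
        (fun j => ((fun l => if j.succ = l then 1 else 0, -1), (d j.succ : ℤ)))
    have hM : ∀ a b, IsWeightedHomogeneous (multidegree n d) (universalMatrix n d a b)
        (row a + col b) := by
      rintro (a | a) (i | j)
      · refine isWeightedHomogeneous_of_eq (universalGrad_isWeightedHomogeneous d i a) ?_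
        simp [row, col]
      · exact isWeightedHomogeneous_zero _ _ _
      · refine isWeightedHomogeneous_of_eq (universalHessMul_isWeightedHomogeneous d i a) ?_
        simp only [row, col, Sum.elim_inl, Sum.elim_inr, Prod.mk_add_mk, zero_add, add_zero]
        congr 1
        ring
      · refine isWeightedHomogeneous_of_eq (universalGrad_isWeightedHomogeneous d j.succ a) ?_
        simp only [row, col, Sum.elim_inr, Prod.mk_add_mk, zero_add]
        congr 1
    exact ⟨_, isWeightedHomogeneous_det _ (fun b => row (c b)) col fun b b' => hM (c b) b'⟩

/-! ### Specialization to given coefficients -/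

section Specialization

variable {K : Type*} [Field K] (d : Fin (k + 1) → ℕ) (p : Fin (k + 1) → MvPolynomial (Fin n) K)
  (y : Fin n → K)

/-- Specialization of the indeterminate coefficients to those of `p`, and of `y`. -/
noncomputable def specialization : MvPolynomial (Variables n d) ℤ →ₐ[ℤ]
    MvPolynomial (Fin (n + 1)) K :=
  aeval (Sum.elim (fun a => C (Sum.elim (coeffs d p) y a)) X)

theorem eval_specialization (x : Fin (n + 1) → K) (F : MvPolynomial (Variables n d) ℤ) :
    eval x (specialization d p y F) = aeval (Sum.elim (Sum.elim (coeffs d p) y) x) F := by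
  induction F using MvPolynomial.induction_on with
  | C a => simp [specialization]
  | add p q hp hq => simp only [map_add, hp, hq]
  | mul_X p i hp =>
    simp only [map_mul, hp]
    rcases i with i | i <;> simp [specialization]

theorem specialization_pderiv (a : Fin (n + 1)) (F : MvPolynomial (Variables n d) ℤ) :
    specialization d p y (pderiv (Sum.inr a) F) = pderiv a (specialization d p y F) := by
  classical
  refine (pderiv_aeval_of_forall _ (Sum.inr a) a ?_ F).symm
  rintro (s | s)
  · simp
  · simp [pderiv_X, Pi.single_apply, eq_comm]

/-- The degree bound puts the support inside the index set, and the additional exponents have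
coefficient zero. The right side has the shape of `universalForm`. -/
theorem homogenization_eq_sum {m : ℕ} {f : MvPolynomial (Fin n) K} (hf : f.totalDegree ≤ m) :
    homogenization m f = ∑ α : {α : Fin n →₀ ℕ // α.degree ≤ m},
      monomial (Finsupp.cons (m - α.1.degree) α.1) (f.coeff α.1) := by
  rw [homogenization, ← Finset.sum_subtype (Finsupp.finite_of_degree_le m).toFinset (by simp)
    fun α => monomial (Finsupp.cons (m - α.degree) α) (f.coeff α)]
  refine Finset.sum_subset (fun α hα => ?_) fun α _ hα => ?_
  · simpa using! (le_totalDegree hα).trans hf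
  · rw [notMem_support_iff.mp hα, monomial_zero]

theorem specialization_universalForm (hp : ∀ i, (p i).totalDegree ≤ d i) (i : Fin (k + 1)) :
    specialization d p y (universalForm n d i) = homogenization (d i) (p i) := by
  rw [homogenization_eq_sum (hp i), universalForm, map_sum]
  refine Finset.sum_congr rfl fun α _ => ?_
  rw [monomial_eq, Finsupp.prod_fintype _ _ (by simp), Fin.prod_univ_succ]
  simp [specialization, coeffs]

theorem aeval_universalForm (hp : ∀ i, (p i).totalDegree ≤ d i) (x : Fin (n + 1) → K)
    (i : Fin (k + 1)) :
    aeval (Sum.elim (Sum.elim (coeffs d p) y) x) (universalForm n d i) =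
      eval x (homogenization (d i) (p i)) := by
  rw [← eval_specialization, specialization_universalForm d p y hp]

theorem aeval_universalGrad (hp : ∀ i, (p i).totalDegree ≤ d i) (x : Fin (n + 1) → K)
    (i : Fin (k + 1)) (a : Fin n) :
    aeval (Sum.elim (Sum.elim (coeffs d p) y) x) (universalGrad n d i a) =
      gradX (homogenization (d i) (p i)) x a := by
  rw [← eval_specialization, universalGrad, specialization_pderiv,
    specialization_universalForm d p y hp, gradX]

theorem aeval_universalHessMul (hp : ∀ i, (p i).totalDegree ≤ d i) (x : Fin (n + 1) → K)
    (i : Fin (k + 1)) (a : Fin n) :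
    aeval (Sum.elim (Sum.elim (coeffs d p) y) x) (universalHessMul n d i a) =
      (hessX (homogenization (d i) (p i)) x).mulVec y a := by
  rw [universalHessMul, map_sum, Matrix.mulVec, dotProduct]
  refine Finset.sum_congr rfl fun b _ => ?_
  rw [map_mul, ← eval_specialization, universalGrad, specialization_pderiv,
    specialization_pderiv, specialization_universalForm d p y hp, aeval_X]
  rfl

theorem aeval_universalMatrix (hp : ∀ i, (p i).totalDegree ≤ d i) (x : Fin (n + 1) → K)
    (a : Fin n ⊕ Fin n) (b : Fin (k + 1) ⊕ Fin k) :
    aeval (Sum.elim (Sum.elim (coeffs d p) y) x) (universalMatrix n d a b) =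
      matrixP (fun i => homogenization (d i) (p i)) x y a b := by
  rcases a with a | a <;> rcases b with b | b
  · exact aeval_universalGrad d p y hp x b a
  · exact map_zero _
  · exact aeval_universalHessMul d p y hp x b a
  · exact aeval_universalGrad d p y hp x b.succ a

/-- As `P̃` has `2k + 1` columns, rank at most `2k` is the failure of full column rank, hence the
vanishing of the maximal minors. -/
theorem hessianDegeneracy_iff_aeval_eq_zero (hp : ∀ i, (p i).totalDegree ≤ d i)
    (x : Fin (n + 1) → K) :
    HessianDegeneracy d p x y ↔
      ∀ j, aeval (Sum.elim (Sum.elim (coeffs d p) y) x) (degeneracyEquation n d j) = 0 := by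
  have hcard : 2 * k + 1 = Fintype.card (Fin (k + 1) ⊕ Fin k) := by
    simp
    ring
  rw [HessianDegeneracy, ← Nat.lt_add_one_iff, hcard, rank_lt_card_iff_det_eq_zero]
  simp only [Sum.forall, degeneracyEquation, aeval_universalForm d p y hp, map_sum, map_mul,
    aeval_universalGrad d p y hp, aeval_X, Sum.elim_inl, Sum.elim_inr, AlgHom.map_det]
  rw [and_comm]
  refine and_congr Iff.rfl (forall_congr' fun c => ?_)
  rw [← sub_eq_zero, sub_zero]
  congr! 2
  ext b b'
  exact (aeval_universalMatrix d p y hp x (c b) b').symm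

end Specialization

end UniversalForm

/-! ### The two eliminations -/

theorem exists_eliminatesX (n : ℕ) {k : ℕ} (d : Fin (k + 1) → ℕ) :
    ∃ (t : ℕ) (G : Fin t → MvPolynomial (CoeffIndex n d ⊕ Fin n) ℤ), EliminatesX n d G := by
  -- The coordinates of `y` count as parameters here and keep their grading, so the eliminants are
  -- forms in `y`, as the second elimination requires.
  obtain ⟨t, G, hG, h⟩ := exists_eliminants (R := ℤ) ℂ
    (fun a => (multidegree n d (Sum.inl a)).1) (degeneracyEquation n d)
    (fun j => by
      obtain ⟨m, hm⟩ := degeneracyEquation_isWeightedHomogeneous d j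
      refine exists_isWeightedHomogeneous_nat
        (isWeightedHomogeneous_comp hm (AddMonoidHom.snd _ _) ?_)
      rintro ((a | a) | a) <;> rfl)
    (fun j => by
      obtain ⟨m, hm⟩ := degeneracyEquation_isWeightedHomogeneous d j
      refine ⟨m.1, isWeightedHomogeneous_comp hm (AddMonoidHom.fst _ _) ?_⟩
      rintro ((a | a) | a) <;> rfl)
  refine ⟨t, G, fun j => ?_, fun p hp y => ?_⟩
  · obtain ⟨m, hm⟩ := hG j
    refine ⟨fun i => exists_isWeightedHomogeneous_nat (isWeightedHomogeneous_comp hm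
        ((Pi.evalAddMonoidHom _ i).comp (AddMonoidHom.fst _ _)) ?_),
      exists_isWeightedHomogeneous_nat
        (isWeightedHomogeneous_comp hm (AddMonoidHom.snd _ _) ?_)⟩
    · rintro (a | a) <;> simp [multidegree]
    · rintro (a | a) <;> rfl
  · simp only [hessianDegeneracy_iff_aeval_eq_zero d p y hp]
    exact h _

theorem exists_eliminatesY (n : ℕ) {k : ℕ} (d : Fin (k + 1) → ℕ) {t : ℕ}
    (G : Fin t → MvPolynomial (CoeffIndex n d ⊕ Fin n) ℤ)
    (hG : ∀ j, HomogeneousInEachAndY (G j)) :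
    ∃ (s : ℕ) (D : Fin s → MvPolynomial (CoeffIndex n d) ℤ), EliminatesY n d G D := by
  obtain ⟨s, D, hD, h⟩ := exists_eliminants (R := ℤ) ℂ
    (fun (c : CoeffIndex n d) (i : Fin (k + 1)) => if c.1 = i then 1 else 0) G
    (fun j => (hG j).2)
    (fun j => by
      choose m hm using (hG j).1
      refine ⟨m, isWeightedHomogeneous_pi fun i => ?_⟩
      refine isWeightedHomogeneous_comp (hm i) (AddMonoidHom.id _) ?_
      rintro (a | a) <;> rfl)
  refine ⟨s, D, fun j i => ?_, fun p _ => h _⟩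
  obtain ⟨m, hm⟩ := hD j
  exact ⟨m i, isWeightedHomogeneous_comp hm (Pi.evalAddMonoidHom (fun _ => ℕ) i)
    fun _ => rfl⟩

/-! ### Setting `x₀ = 1` -/

section Dehomogenization

variable {K : Type*} [Field K] {n : ℕ}

/-- Substitution of `1` for `x₀`. -/
noncomputable def dehomogenization :
    MvPolynomial (Fin (n + 1)) K →ₐ[K] MvPolynomial (Fin n) K :=
  aeval (Fin.cons 1 X)

theorem dehomogenization_homogenization (m : ℕ) (f : MvPolynomial (Fin n) K) :
    dehomogenization (homogenization m f) = f := by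
  rw [homogenization, map_sum]
  conv_rhs => rw [f.as_sum]
  refine Finset.sum_congr rfl fun α _ => ?_
  rw [dehomogenization, aeval_monomial, Finsupp.prod_fintype _ _ (by simp), Fin.prod_univ_succ,
    monomial_eq, Finsupp.prod_fintype _ _ (by simp)]
  simp [MvPolynomial.algebraMap_eq]

theorem eval_dehomogenization (x : Fin n → K) (q : MvPolynomial (Fin (n + 1)) K) :
    eval x (dehomogenization q) = eval (Fin.cons 1 x) q := by
  induction q using MvPolynomial.induction_on with
  | C a => simp [dehomogenization]
  | add p q hp hq => simp only [map_add, hp, hq]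
  | mul_X p i hp =>
    simp only [map_mul, hp]
    refine Fin.cases ?_ (fun i => ?_) i <;> simp [dehomogenization]

theorem dehomogenization_pderiv (a : Fin n) (q : MvPolynomial (Fin (n + 1)) K) :
    dehomogenization (pderiv a.succ q) = pderiv a (dehomogenization q) := by
  refine (pderiv_aeval_of_forall _ a.succ a (fun s => ?_) q).symm
  refine Fin.cases ?_ (fun s => ?_) s
  · simp [(Fin.succ_ne_zero a).symm]
  · simp [pderiv_X, Pi.single_apply, eq_comm]

theorem eval_homogenization (m : ℕ) (f : MvPolynomial (Fin n) K) (x : Fin n → K) :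
    eval (Fin.cons 1 x) (homogenization m f) = eval x f := by
  rw [← eval_dehomogenization, dehomogenization_homogenization]

theorem gradX_homogenization (m : ℕ) (f : MvPolynomial (Fin n) K) (x : Fin n → K) :
    gradX (homogenization m f) (Fin.cons 1 x) = grad f x := by
  ext a
  rw [gradX, ← eval_dehomogenization, dehomogenization_pderiv, dehomogenization_homogenization,
    grad]

theorem hessX_homogenization (m : ℕ) (f : MvPolynomial (Fin n) K) (x : Fin n → K) :
    hessX (homogenization m f) (Fin.cons 1 x) = hess f x := by
  ext a b
  rw [hessX, Matrix.of_apply, ← eval_dehomogenization, dehomogenization_pderiv,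
    dehomogenization_pderiv, dehomogenization_homogenization, hess, Matrix.of_apply]

end Dehomogenization

/-! ### From a singular KKT matrix to a degenerate point -/

section CriticalPair

variable {K : Type*} [Field K] {n k : ℕ} (p : Fin (k + 1) → MvPolynomial (Fin n) K)

theorem hess_lagrangian (lam : Fin k → K) (x : Fin n → K) :
    hess (lagrangian p lam) x = hess (p 0) x - ∑ j, lam j • hess (p j.succ) x := by
  ext a b
  simp [hess, lagrangian, Matrix.sum_apply]

theorem matrixP_homogenization_mulVec (d : Fin (k + 1) → ℕ) (x y : Fin n → K)
    (u : Fin (k + 1) → K) (v : Fin k → K) :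
    (matrixP (fun i => homogenization (d i) (p i)) (Fin.cons 1 x) y).mulVec (Sum.elim u v) =
      Sum.elim (∑ i, u i • grad (p i) x)
        (∑ i, u i • (hess (p i) x).mulVec y + ∑ j, v j • grad (p j.succ) x) := by
  rw [matrixP, Matrix.fromBlocks_mulVec]
  simp only [gradX_homogenization, hessX_homogenization]
  ext (a | a) <;> simp [Matrix.mulVec, dotProduct, mul_comm]

/-- A critical pair with singular KKT matrix yields a solution of the homogenized
Hessian-degeneracy system. -/
theorem exists_hessianDegeneracy_of_det_eq_zero (hk : k ≤ n) (d : Fin (k + 1) → ℕ)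
    {x : Fin n → K} {lam : Fin k → K} (hx : IsCriticalPair p x lam)
    (hdet : (kktMatrix p x lam).det = 0) :
    ∃ (x' : Fin (n + 1) → K) (y : Fin n → K), x' ≠ 0 ∧ y ≠ 0 ∧ HessianDegeneracy d p x' y := by
  obtain ⟨z, hz, hz0⟩ := Matrix.exists_mulVec_eq_zero_iff.mpr hdet
  set y : Fin n → K := fun a => z (Sum.inl a) with hy
  set μ : Fin k → K := fun j => z (Sum.inr j) with hμ
  have hzs : z = Sum.elim y μ := by
    ext (a | a) <;> rfl
  rw [hzs, kktMatrix, Matrix.fromBlocks_mulVec] at hz0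
  have h1 : (hess (lagrangian p lam) x).mulVec y + (jac p x).transpose.mulVec μ = 0 := by
    ext a
    simpa using congrFun hz0 (Sum.inl a)
  have h2 : (jac p x).mulVec y = 0 := by
    ext j
    simpa using congrFun hz0 (Sum.inr j)
  have hjac : (jac p x).transpose.mulVec μ = ∑ j, μ j • grad (p j.succ) x := by
    ext a
    simp [Matrix.mulVec, dotProduct, jac, mul_comm]
  rw [hjac] at h1
  have hcard : 2 * k + 1 = Fintype.card (Fin (k + 1) ⊕ Fin k) := by
    simp
    ring
  -- At `x̃ = (1, x)` it suffices to find a nonzero `y'` in the kernel of the Jacobian and a nonzero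
  -- kernel vector `(u, v)` of `P̃`.
  have key : ∀ y' : Fin n → K, y' ≠ 0 → (jac p x).mulVec y' = 0 →
      ∀ (u : Fin (k + 1) → K) (v : Fin k → K), Sum.elim u v ≠ 0 → ∑ i, u i • grad (p i) x = 0 →
      ∑ i, u i • (hess (p i) x).mulVec y' + ∑ j, v j • grad (p j.succ) x = 0 →
      ∃ (x' : Fin (n + 1) → K) (y : Fin n → K),
        x' ≠ 0 ∧ y ≠ 0 ∧ HessianDegeneracy d p x' y := by
    intro y' hy' hJ u v huv hu hv
    refine ⟨Fin.cons 1 x, y', fun h => one_ne_zero (congrFun h 0), hy', ?_, fun j => ?_,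
      fun j => ?_⟩
    · rw [← Nat.lt_add_one_iff, hcard, rank_lt_card_iff_exists_mulVec_eq_zero]
      refine ⟨Sum.elim u v, huv, ?_⟩
      rw [matrixP_homogenization_mulVec, hu, hv]
      ext (a | a) <;> rfl
    · rw [eval_homogenization]
      exact hx.2 j
    · rw [gradX_homogenization]
      exact congrFun hJ j
  -- If `y = 0`, then `μ ≠ 0` is a relation between the constraint gradients, so the Jacobian has
  -- rank less than `k ≤ n` and kills some `y' ≠ 0`; the kernel vector is `(0, μ)`.
  by_cases hy0 : y = 0
  · have hμ0 : μ ≠ 0 := by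
      rintro h
      refine hz ?_
      rw [hzs, hy0, h]
      ext (a | a) <;> rfl
    rw [hy0, Matrix.mulVec_zero, zero_add] at h1
    have hrank : (jac p x).rank < Fintype.card (Fin n) := by
      rw [← Matrix.rank_transpose]
      refine lt_of_lt_of_le ((rank_lt_card_iff_exists_mulVec_eq_zero _).mpr
        ⟨μ, hμ0, hjac.trans h1⟩) ?_
      simpa using hk
    obtain ⟨y', hy', hJ⟩ := (rank_lt_card_iff_exists_mulVec_eq_zero _).mp hrank
    refine key y' hy' hJ 0 μ (fun h => hμ0 ?_) (by simp) (by simpa using h1)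
    ext j
    exact congrFun h (Sum.inr j)
  -- With `u = (1, -λ)` the upper block is the KKT equation, and with `v = μ` the lower block is the
  -- upper half of the kernel equation for the KKT matrix.
  · refine key y hy0 h2 (Fin.cons 1 fun j => -lam j) μ
      (fun h => one_ne_zero (congrFun h (Sum.inl 0))) ?_ ?_
    · rw [Fin.sum_univ_succ, ← hx.1, sub_eq_add_neg]
      simp
    · rw [← h1, hess_lagrangian, Fin.sum_univ_succ, Matrix.sub_mulVec, Matrix.sum_mulVec]
      simp [Matrix.smul_mulVec, sub_eq_add_neg]

end CriticalPair

end KKTDisc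

/-! ### The discriminant -/

theorem proposition4p2 (n k : ℕ) (hk : k ≤ n) (d : Fin (k + 1) → ℕ) :
    ∃ 𝓓 : MvPolynomial (KKTDisc.CoeffIndex n d) ℤ,
      KKTDisc.IsTwofoldEliminant n d 𝓓 ∧
      ∀ p : Fin (k + 1) → MvPolynomial (Fin n) ℝ, (∀ i, (p i).totalDegree ≤ d i) →
        ((∃ (x : Fin (n + 1) → ℂ) (y : Fin n → ℂ), x ≠ 0 ∧ y ≠ 0 ∧
            KKTDisc.HessianDegeneracy d (KKTDisc.complexify p) x y) ↔
          MvPolynomial.aeval (KKTDisc.coeffs d p) 𝓓 = 0) ∧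
        (MvPolynomial.aeval (KKTDisc.coeffs d p) 𝓓 ≠ 0 →
          KKTDisc.KKTNonsingular (KKTDisc.complexify p)) := by
  obtain ⟨t, G, hG⟩ := KKTDisc.exists_eliminatesX n d
  obtain ⟨s, D, hD⟩ := KKTDisc.exists_eliminatesY n d G hG.1
  refine ⟨∑ j, D j ^ 2, ⟨t, s, G, D, hG, hD, rfl⟩, fun p hp => ?_⟩
  have hpc : ∀ i, (KKTDisc.complexify p i).totalDegree ≤ d i := fun i =>
    (Finset.sup_mono (MvPolynomial.support_map_subset _ _)).trans (hp i)
  have hiff : (∃ (x : Fin (n + 1) → ℂ) (y : Fin n → ℂ), x ≠ 0 ∧ y ≠ 0 ∧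
      KKTDisc.HessianDegeneracy d (KKTDisc.complexify p) x y) ↔
      MvPolynomial.aeval (KKTDisc.coeffs d p) (∑ j, D j ^ 2) = 0 := by
    have hc : KKTDisc.coeffs d (KKTDisc.complexify p) =
        algebraMap ℝ ℂ ∘ KKTDisc.coeffs d p := by
      funext c
      exact MvPolynomial.coeff_map _ _ _
    have h1 : (∃ (x : Fin (n + 1) → ℂ) (y : Fin n → ℂ), x ≠ 0 ∧ y ≠ 0 ∧
        KKTDisc.HessianDegeneracy d (KKTDisc.complexify p) x y) ↔ ∃ y : Fin n → ℂ, y ≠ 0 ∧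
        ∃ x : Fin (n + 1) → ℂ, x ≠ 0 ∧
          KKTDisc.HessianDegeneracy d (KKTDisc.complexify p) x y :=
      ⟨fun ⟨x, y, hx, hy, h⟩ => ⟨y, hy, x, hx, h⟩, fun ⟨y, hy, x, hx, h⟩ => ⟨x, y, hx, hy, h⟩⟩
    simp only [h1, hG.2 _ hpc, hD.2 _ hpc]
    -- Evaluated at the real coefficients, the `D j` are real, so their sum of squares vanishes only
    -- termwise; over `ℂ` this would fail.
    rw [map_sum, Finset.sum_eq_zero_iff_of_nonneg fun j _ => by
      rw [map_pow]
      exact sq_nonneg _]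
    refine ⟨fun h j _ => ?_, fun h j => ?_⟩
    · have := h j
      rw [hc, MvPolynomial.aeval_algebraMap_apply, map_eq_zero] at this
      rw [map_pow, this, zero_pow two_ne_zero]
    · have := h j (Finset.mem_univ j)
      rw [map_pow] at this
      rw [hc, MvPolynomial.aeval_algebraMap_apply, eq_zero_of_pow_eq_zero this, map_zero]
  refine ⟨hiff, fun h x lam hx hdet => h (hiff.mp ?_)⟩
  exact KKTDisc.exists_hessianDegeneracy_of_det_eq_zero _ hk d hx hdet
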